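/- Let $d\ge 2$ and $\omega=e^{2\pi i/d}$; indices are taken modulo $d$. For a $d$-tuple $\Theta=(\theta_0,\dots,\theta_{d-1})$ of complex numbers of modulus one, put $U_\Theta=\frac1{\sqrt d}\sum_{k,l}\omega^{kl}\theta_l|k\rangle\langle l|$, $Z=\sum_k\omega^k|k\rangle\langle k|$ and $Z_\Theta=U_\Theta^\dagger ZU_\Theta$. A measurement basis of an operator is an orthonormal basis of eigenvectors of it. For $|\theta|=1$ write $A_a$ and $B_b$ for the operators $Z_\Theta$ with $\Theta=(\theta^{aj})_{j}$ and $\Theta=(\theta^{-bj})_{j}$ respectively. *Bases.* The N-DEB bases are the measurement bases of $A_0,\dots,A_3$ and $B_0,\dots,B_3$. The $2d$ bases of hdDEB are the measurement bases of the observables $\mathscr A_a=A_0^{d-1-a}A_1^{a}$ and $\mathscr B_b=B_0^{d-1-b}B_1^{b}$, $0\le a,b\le d-1$; the claims below hold also when $\mathscr A_a,\mathscr B_b$ are read as the ditter observables with phase shifts $(\theta^{aj})_j$ and $(\theta^{-bj})_j$. A phase state is a vector $\frac1{\sqrt d}\sum_j e^{i\gamma_j}|j\rangle$ with real $\gamma_j$.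 *Cloners.* A phase-covariant cloner is an isometry $V:\mathbb C^d\to\mathbb C^d_A\otimes\mathbb C^d_B\otimes\mathbb C^d_C$ with $VU=(U\otimes U\otimes\overline U)V$ for every unitary $U$ that is a product of a diagonal unitary and a permutation matrix (these are exactly the unitaries that preserve the set of phase states). Its fidelity on $\psi$ is $\langle\psi|\rho_A|\psi\rangle$, where $\rho_A=\mathrm{Tr}_{BC}\,V|\psi\rangle\langle\psi|V^\dagger$. For an orthonormal basis $e=(e_k)$, let the input be a uniformly random $e_k$; let $I_{AB}(V,e)$ be the mutual information between $k$ and the result of measuring $A$ in the basis $e$, and $I_{AE}(V,e)$ the mutual information between $k$ and the results of measuring $B$ in the basis $e$ and $C$ in the complex conjugate basis $\overline e$. For a set $S$ of bases, call $V$ *optimal for $S$ with fidelity $F$* if it is a phase-covariant cloner, $I_{AB}(V,e)\le I_{AE}(V,e)$ for all $e\in S$, every vector of every $e\in S$ is copied with fidelity $F$, and every phase-covariant cloner $W$ with $I_{AB}(W,e)\le I_{AE}(W,e)$ for all $e\in S$ copies every vector of every $e\in S$ with fidelity at most $F$. For real $v,x,y$ let $V_{v,x,y}|\psi\rangle=\sum_{m,n}a_{m,n}\,U_{m,n}|\psi\rangle_A\otimes|B_{m,-n}\rangle_{BC}$,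 where $U_{m,n}=\sum_k\omega^{kn}|k+m\rangle\langle k|$, $|B_{m,-n}\rangle=\frac1{\sqrt d}\sum_k\omega^{-kn}|k\rangle|k+m\rangle$, $a_{0,0}=v$, $a_{0,n}=x$ for $n\ne0$, and $a_{m,n}=y$ for $m\neq0$. **Proposition.** There are real numbers $F_A,v,x,y$, depending only on $d$, such that for every $\theta$ with $|\theta|=1$ the cloner $V_{v,x,y}$ is optimal for the N-DEB bases with fidelity $F_A$. Moreover, for every such $\theta$ and every cloner $V$ that is optimal for the N-DEB bases with fidelity $F_A$: 1. every vector of each of the $2d$ hdDEB bases is a phase state; 2. $V$ is optimal with the same fidelity $F_A$ for the set of all measurement bases of all operators $Z_\Theta$; 3. $V$ is optimal with the same fidelity $F_A$ for the set of the $2d$ hdDEB bases, and also for each of these bases alone. In particular, all their vectors are copied with the maximal fidelity $F_A$. -/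

import Mathlib

open scoped Matrix Kronecker

noncomputable section

namespace QuditCloning

/-- A single-qudit vector, given by its coordinates in the computational basis. -/
abbrev Qudit (d : ℕ) : Type := Fin d → ℂ

/-- The principal `d`-th root of unity `ω = exp (2πi/d)`. -/
def omega (d : ℕ) : ℂ := Complex.exp (2 * Real.pi * Complex.I / d)

/-! ### Ditters, observables and measurement bases -/

/-- A `d`-tuple of phase shifts: complex numbers of modulus one. -/
def IsPhaseTuple {d : ℕ} (Θ : Fin d → ℂ) : Prop := ∀ j, ‖Θ j‖ = 1

/-- The ditter unitary `U_Θ = d^{-1/2} ∑ ω^{kl} θ_l |k⟩⟨l|`. -/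
def ditter {d : ℕ} (Θ : Fin d → ℂ) : Matrix (Fin d) (Fin d) ℂ :=
  Matrix.of fun k l => ((Real.sqrt d : ℝ) : ℂ)⁻¹ * omega d ^ ((k : ℕ) * (l : ℕ)) * Θ l

/-- The detector observable `Z = ∑ ω^k |k⟩⟨k|`. -/
def clockZ (d : ℕ) : Matrix (Fin d) (Fin d) ℂ :=
  Matrix.diagonal fun k => omega d ^ (k : ℕ)

/-- The observable `Z_Θ` of a ditter followed by detectors in the computational basis. -/
def ditterObs {d : ℕ} (Θ : Fin d → ℂ) : Matrix (Fin d) (Fin d) ℂ :=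
  (ditter Θ)ᴴ * clockZ d * ditter Θ

/-- The phase shifts `(1, θ^a, θ^{2a}, …, θ^{(d-1)a})`. -/
def geomPhases (d : ℕ) (θ : ℂ) (a : ℕ) : Fin d → ℂ := fun j => θ ^ ((j : ℕ) * a)

/-- `e` is an orthonormal basis of eigenvectors of `T`, i.e. a basis in which `T` is measured. -/
def IsMeasurementBasis {d : ℕ} (T : Matrix (Fin d) (Fin d) ℂ) (e : Fin d → Qudit d) : Prop :=
  (∀ k l, star (e k) ⬝ᵥ e l = if k = l then 1 else 0) ∧
    ∀ k, ∃ μ : ℂ, T *ᵥ e k = μ • e k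

/-- `ψ = d^{-1/2} ∑ e^{iγ_j} |j⟩` for some real `γ_j`. -/
def IsPhaseState {d : ℕ} (ψ : Qudit d) : Prop :=
  ∃ γ : Fin d → ℝ, ∀ j, ψ j = ((Real.sqrt d : ℝ) : ℂ)⁻¹ * Complex.exp (Complex.I * γ j)

/-- All bases measured with a ditter. -/
def ditterBases (d : ℕ) : Set (Fin d → Qudit d) :=
  {e | ∃ Θ : Fin d → ℂ, IsPhaseTuple Θ ∧ IsMeasurementBasis (ditterObs Θ) e}

/-- The bases of the N-DEB protocol: the observables `A_0, …, A_3` of one party, with phase shifts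
`(θ^{aj})_j`, and `B_0, …, B_3` of the other, with phase shifts `(θ^{-bj})_j`. -/
def ndebBases (d : ℕ) (θ : ℂ) : Set (Fin d → Qudit d) :=
  {e | ∃ a : ℕ, a < 4 ∧
    (IsMeasurementBasis (ditterObs (geomPhases d θ a)) e ∨
      IsMeasurementBasis (ditterObs (geomPhases d θ⁻¹ a)) e)}

/-- The product observable `A_0^{d-1-a} A_1^a`, where `A_0` and `A_1` are the ditter observables
with phase shifts `(1, …, 1)` and `(1, θ, …, θ^{d-1})`. -/
def productObs (d : ℕ) (θ : ℂ) (a : ℕ) : Matrix (Fin d) (Fin d) ℂ :=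
  ditterObs (geomPhases d θ 0) ^ (d - 1 - a) * ditterObs (geomPhases d θ 1) ^ a

/-- The bases of the hdDEB protocol, indexed by `a = 0, …, d-1` and by the party (`θ` for one and
`θ⁻¹` for the other). The protocol describes the `a`-th observable both as the product
`A_0^{d-1-a} A_1^a` and as the ditter observable with phase shifts `(1, θ^a, …, θ^{(d-1)a})`; the
measurement bases of both are included. -/
def hddebBases (d : ℕ) (θ : ℂ) : Set (Fin d → Qudit d) :=
  {e | ∃ a : ℕ, a < d ∧
    ((IsMeasurementBasis (productObs d θ a) e ∨
        IsMeasurementBasis (ditterObs (geomPhases d θ a)) e) ∨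
      (IsMeasurementBasis (productObs d θ⁻¹ a) e ∨
        IsMeasurementBasis (ditterObs (geomPhases d θ⁻¹ a)) e))}

/-! ### Cloning machines -/

/-- A linear map from one qudit to three: `A` (the copy sent on), `B` (the copy kept by the
adversary) and `C` (the internal state of the machine, kept by the adversary). -/
abbrev Machine (d : ℕ) : Type := Matrix (Fin d × (Fin d × Fin d)) (Fin d) ℂ

/-- The unitary `∑ e^{iγ_j} |j⟩⟨σ j|`. These are the unitaries that preserve the
class of phase states. -/
def phasePerm {d : ℕ} (γ : Fin d → ℝ) (σ : Equiv.Perm (Fin d)) : Matrix (Fin d) (Fin d) ℂ :=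
  Matrix.of fun i j => if j = σ i then Complex.exp (Complex.I * γ i) else 0

/-- A phase-covariant cloner: an isometry such that both copies transform like the input, and the
machine like its complex conjugate, under every `phasePerm γ σ`. -/
structure IsPhaseCovariantCloner {d : ℕ} (V : Machine d) : Prop where
  isometry : Vᴴ * V = 1
  covariant : ∀ (γ : Fin d → ℝ) (σ : Equiv.Perm (Fin d)),
    V * phasePerm γ σ =
      (phasePerm γ σ ⊗ₖ (phasePerm γ σ ⊗ₖ (phasePerm γ σ).map star)) * V

/-- The error operator `U_{m,n} = ∑ ω^{kn} |k+m⟩⟨k|`, indices modulo `d`. -/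
def errorOp {d : ℕ} (m n : Fin d) : Matrix (Fin d) (Fin d) ℂ :=
  Matrix.of fun j k =>
    if (j : ℕ) = ((k : ℕ) + (m : ℕ)) % d then omega d ^ ((k : ℕ) * (n : ℕ)) else 0

/-- The Bell state `B_{m,-n} = d^{-1/2} ∑ ω^{-kn} |k⟩|k+m⟩`, indices modulo `d`. -/
def bellState {d : ℕ} (m n : Fin d) : Fin d × Fin d → ℂ := fun p =>
  if (p.2 : ℕ) = ((p.1 : ℕ) + (m : ℕ)) % d then
    ((Real.sqrt d : ℝ) : ℂ)⁻¹ * star (omega d ^ ((p.1 : ℕ) * (n : ℕ)))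
  else 0

/-- The amplitude matrix whose row `0` is `(v, x, …, x)` and whose other entries are `y`. -/
def amplitude {d : ℕ} (v x y : ℝ) (m n : Fin d) : ℝ :=
  if (m : ℕ) = 0 then (if (n : ℕ) = 0 then v else x) else y

/-- The cloner `|ψ⟩ ↦ ∑_{m,n} a_{m,n} U_{m,n}|ψ⟩_A |B_{m,-n}⟩_{BC}` with the amplitudes
`amplitude v x y`. -/
def bellCloner (d : ℕ) (v x y : ℝ) : Machine d :=
  Matrix.of fun s i =>
    ∑ m : Fin d, ∑ n : Fin d, (amplitude v x y m n : ℂ) * errorOp m n s.1 i * bellState m n s.2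

/-! ### Fidelity and information -/

/-- The density matrix of the copy `A` for the input `ψ`. -/
def cloneDensity {d : ℕ} (V : Machine d) (ψ : Qudit d) : Matrix (Fin d) (Fin d) ℂ :=
  Matrix.of fun i j => ∑ s : Fin d × Fin d, (V *ᵥ ψ) (i, s) * star ((V *ᵥ ψ) (j, s))

/-- The probability `⟨φ|ρ_A|φ⟩` of finding the copy `A` in the state `φ`, for the input `ψ`. -/
def cloneProb {d : ℕ} (V : Machine d) (ψ φ : Qudit d) : ℝ :=
  (star φ ⬝ᵥ (cloneDensity V ψ *ᵥ φ)).re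

/-- The fidelity `⟨ψ|ρ_A|ψ⟩` with which `V` copies `ψ`. -/
def fidelity {d : ℕ} (V : Machine d) (ψ : Qudit d) : ℝ := cloneProb V ψ ψ

/-- The probability that the adversary, for the input `ψ`, finds `B` in the state `φ` and `C` in
the state complex conjugate to `χ`. -/
def adversaryProb {d : ℕ} (V : Machine d) (ψ φ χ : Qudit d) : ℝ :=
  ∑ i : Fin d, ‖∑ p : Fin d × Fin d, star (φ p.1) * χ p.2 * (V *ᵥ ψ) (i, p)‖ ^ 2

/-- Mutual information (in nats) of a joint distribution on a finite product. -/
def mutualInfo {α β : Type*} [Fintype α] [Fintype β] (P : α → β → ℝ) : ℝ :=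
  ∑ a, Real.negMulLog (∑ b, P a b) + ∑ b, Real.negMulLog (∑ a, P a b)
    - ∑ a, ∑ b, Real.negMulLog (P a b)

/-- The information of the legitimate receiver: the input is a uniformly random vector of the
basis `e` and the copy `A` is measured in the basis `e`. -/
def receiverInfo {d : ℕ} (V : Machine d) (e : Fin d → Qudit d) : ℝ :=
  mutualInfo fun k l : Fin d => (d : ℝ)⁻¹ * cloneProb V (e k) (e l)

/-- The information of the adversary: the input is a uniformly random vector of the basis `e`,
`B` is measured in the basis `e` and `C` in the complex conjugate basis. -/
def adversaryInfo {d : ℕ} (V : Machine d) (e : Fin d → Qudit d) : ℝ :=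
  mutualInfo fun (k : Fin d) (q : Fin d × Fin d) =>
    (d : ℝ)⁻¹ * adversaryProb V (e k) (e q.1) (e q.2)

/-- On every basis of `S` the adversary is at least as well informed as the receiver. -/
def Breaks {d : ℕ} (S : Set (Fin d → Qudit d)) (V : Machine d) : Prop :=
  ∀ e ∈ S, receiverInfo V e ≤ adversaryInfo V e

/-- `V` is an optimal phase-covariant cloner for the bases in `S`, with fidelity `F`: it breaks
the bases in `S`, copies all their vectors with fidelity `F`, and no phase-covariant cloner that
breaks the bases in `S` copies any of their vectors with a larger fidelity. -/
structure IsOptimalCloner {d : ℕ} (S : Set (Fin d → Qudit d)) (V : Machine d) (F : ℝ) :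
    Prop where
  phaseCovariant : IsPhaseCovariantCloner V
  breaks : Breaks S V
  fidelity_eq : ∀ e ∈ S, ∀ k, fidelity V (e k) = F
  maximal : ∀ W : Machine d, IsPhaseCovariantCloner W → Breaks S W →
    ∀ e ∈ S, ∀ k, fidelity W (e k) ≤ F

end QuditCloning

end

noncomputable section

namespace QuditCloning

/-! ### Bases of phase states -/

/-! The proof shows that optimality does not depend on the choice of basis. Conjugating the clock by
a ditter gives a weighted cyclic shift with unimodular weights. An eigenvector of such a shift, or
of a product of `d - 1` of them, has all coordinates of equal modulus
(`isUnbiased_of_shiftsModuli`). So every basis involved is an orthonormal basis of phase states,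
which `IsUnbiased` records.

On the other side, covariance under diagonal unitaries and permutations leaves only a
three-parameter family of machines, `complexCloner d v x y`, and the isometry condition is one
quadratic equation in the moduli (`IsPhaseCovariantCloner.exists_eq_complexCloner`,
`isPhaseCovariantCloner_complexCloner`). In an unbiased basis all outcome probabilities are
functions of `v`, `x`, `y` alone, so the information inequality becomes a single condition
`BreaksUnbiased`, the same for every such basis, and the fidelity is `‖v‖² + (d - 1)‖y‖²`. A cloner
that breaks one unbiased basis and attains the maximal fidelity on it is therefore optimal for any
set of unbiased bases (`isOptimalCloner_of_isUnbiased`).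

It remains to find a maximum at real amplitudes. The feasible real amplitudes form a nonempty
compact set. Complex ones do no better: for fixed moduli the adversary's information is largest when
the relative phases are signs, by concavity of entropy (`BreaksUnbiased.exists_real`). -/

lemma omega_pow_self {d : ℕ} (hd : d ≠ 0) : omega d ^ d = 1 :=
  (Complex.isPrimitiveRoot_exp d hd).pow_eq_one

lemma omega_mul_star {d : ℕ} (hd : d ≠ 0) (n : ℕ) : omega d ^ n * star (omega d ^ n) = 1 := by
  have h : ‖omega d‖ = 1 := Complex.norm_eq_one_of_pow_eq_one (omega_pow_self hd) hd
  rw [Complex.star_def, Complex.mul_conj, Complex.normSq_eq_norm_sq, norm_pow, h]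
  simp

lemma omega_pow_eq_iff {d : ℕ} (hd : d ≠ 0) (i j : ℕ) :
    omega d ^ i = omega d ^ j ↔ i % d = j % d := by
  have hp : IsPrimitiveRoot (omega d) d := Complex.isPrimitiveRoot_exp d hd
  have hpos := Nat.pos_of_ne_zero hd
  rw [pow_eq_pow_mod i hp.pow_eq_one, pow_eq_pow_mod j hp.pow_eq_one]
  exact ⟨fun h => hp.pow_inj (Nat.mod_lt _ hpos) (Nat.mod_lt _ hpos) h, fun h => by rw [h]⟩

lemma sum_omega_pow_mul_star {d : ℕ} (hd : d ≠ 0) (i j : ℕ) :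
    ∑ k : Fin d, omega d ^ ((k : ℕ) * i) * star (omega d ^ ((k : ℕ) * j)) =
      if i % d = j % d then (d : ℂ) else 0 := by
  have hpow : ∀ k : ℕ, omega d ^ (k * i) * star (omega d ^ (k * j)) =
      (omega d ^ i * star (omega d ^ j)) ^ k := fun k => by
    rw [mul_pow, ← pow_mul, ← star_pow, ← pow_mul, mul_comm i, mul_comm j]
  simp only [hpow]
  rw [Fin.sum_univ_eq_sum_range (fun k => (omega d ^ i * star (omega d ^ j)) ^ k) d]
  split_ifs with h
  · rw [(omega_pow_eq_iff hd i j).2 h, omega_mul_star hd]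
    simp
  · have hne : omega d ^ i * star (omega d ^ j) ≠ 1 := by
      intro h1
      apply h
      rw [← omega_pow_eq_iff hd]
      calc omega d ^ i = omega d ^ i * star (omega d ^ j) * omega d ^ j := by
            rw [mul_assoc, mul_comm (star _), omega_mul_star hd, mul_one]
        _ = omega d ^ j := by rw [h1, one_mul]
    have hd1 : (omega d ^ i * star (omega d ^ j)) ^ d = 1 := by
      rw [mul_pow, ← star_pow, ← pow_mul, ← pow_mul, mul_comm i, mul_comm j, pow_mul, pow_mul,
        omega_pow_self hd]
      simp
    have := mul_neg_geom_sum (omega d ^ i * star (omega d ^ j)) d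
    rw [hd1, sub_self] at this
    exact (mul_eq_zero.1 this).resolve_left (sub_ne_zero.2 hne.symm)

lemma ofReal_sqrt_mul_self (d : ℕ) : ((Real.sqrt d : ℝ) : ℂ) * ((Real.sqrt d : ℝ) : ℂ) = d := by
  rw [← Complex.ofReal_mul, Real.mul_self_sqrt (Nat.cast_nonneg d)]
  simp

lemma IsPhaseTuple.mul_star {d : ℕ} {Θ : Fin d → ℂ} (hΘ : IsPhaseTuple Θ) (j : Fin d) :
    Θ j * star (Θ j) = 1 := by
  rw [Complex.star_def, Complex.mul_conj, Complex.normSq_eq_norm_sq, hΘ j]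
  simp

lemma isPhaseTuple_geomPhases (d : ℕ) {θ : ℂ} (hθ : ‖θ‖ = 1) (a : ℕ) :
    IsPhaseTuple (geomPhases d θ a) := fun j => by
  simp [geomPhases, hθ]

lemma ditter_mul_conjTranspose {d : ℕ} (hd : d ≠ 0) {Θ : Fin d → ℂ} (hΘ : IsPhaseTuple Θ) :
    ditter Θ * (ditter Θ)ᴴ = 1 := by
  have hdc : (d : ℂ) ≠ 0 := Nat.cast_ne_zero.2 hd
  ext k l
  rw [Matrix.mul_apply, Matrix.one_apply]
  have : ∀ j : Fin d, ditter Θ k j * (ditter Θ)ᴴ j l =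
      (d : ℂ)⁻¹ * (omega d ^ ((j : ℕ) * k) * star (omega d ^ ((j : ℕ) * l))) := fun j => by
    rw [Matrix.conjTranspose_apply]
    simp only [ditter, Matrix.of_apply, star_mul', star_inv₀]
    rw [Complex.star_def, Complex.conj_ofReal, ← ofReal_sqrt_mul_self, mul_inv,
      mul_comm (j : ℕ), mul_comm (j : ℕ)]
    simp only [← Complex.star_def]
    linear_combination (((Real.sqrt d : ℝ) : ℂ)⁻¹ * ((Real.sqrt d : ℝ) : ℂ)⁻¹ *
      omega d ^ ((k : ℕ) * j) * star (omega d ^ ((l : ℕ) * j))) * hΘ.mul_star j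
  simp only [this]
  rw [← Finset.mul_sum, sum_omega_pow_mul_star hd, Nat.mod_eq_of_lt k.2, Nat.mod_eq_of_lt l.2]
  simp only [Fin.ext_iff]
  split_ifs
  · exact inv_mul_cancel₀ hdc
  · simp

lemma isMeasurementBasis_ditterObs {d : ℕ} (hd : d ≠ 0) {Θ : Fin d → ℂ} (hΘ : IsPhaseTuple Θ) :
    IsMeasurementBasis (ditterObs Θ) fun k => (ditter Θ)ᴴ *ᵥ Pi.single k 1 := by
  have hU := ditter_mul_conjTranspose hd hΘ
  refine ⟨fun k l => ?_, fun k => ⟨omega d ^ (k : ℕ), ?_⟩⟩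
  · rw [Matrix.star_mulVec, Matrix.conjTranspose_conjTranspose, Matrix.dotProduct_mulVec,
      Matrix.vecMul_vecMul, hU, Matrix.vecMul_one, dotProduct_single]
    simp [Pi.single_apply, eq_comm]
  · rw [ditterObs, Matrix.mulVec_mulVec, Matrix.mul_assoc, hU, Matrix.mul_one,
      ← Matrix.mulVec_mulVec]
    have : clockZ d *ᵥ Pi.single k 1 = omega d ^ (k : ℕ) • (Pi.single k 1 : Fin d → ℂ) := by
      ext j
      rw [clockZ, Matrix.mulVec_diagonal]
      by_cases h : j = k
      · simp [h]
      · simp [h]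
    rw [this, Matrix.mulVec_smul]

/-- The Fourier matrix turns the clock into the cyclic shift, by orthogonality of characters; the
phase shifts only attach unimodular weights to it. -/
lemma ditterObs_apply {d : ℕ} (hd : d ≠ 0) (Θ : Fin d → ℂ) (i j : Fin d) :
    ditterObs Θ i j = if ((j : ℕ) + 1) % d = i then star (Θ i) * Θ j else 0 := by
  have hdc : (d : ℂ) ≠ 0 := Nat.cast_ne_zero.2 hd
  rw [ditterObs, Matrix.mul_apply]
  have : ∀ k : Fin d, ((ditter Θ)ᴴ * clockZ d) i k * ditter Θ k j =
      (d : ℂ)⁻¹ * (star (Θ i) * Θ j) *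
        (omega d ^ ((k : ℕ) * (j + 1)) * star (omega d ^ ((k : ℕ) * i))) := fun k => by
    rw [clockZ, Matrix.mul_diagonal, Matrix.conjTranspose_apply]
    simp only [ditter, Matrix.of_apply, star_mul', star_inv₀]
    rw [Complex.star_def, Complex.conj_ofReal, ← ofReal_sqrt_mul_self, mul_inv]
    ring
  simp only [this]
  rw [← Finset.mul_sum, sum_omega_pow_mul_star hd, Nat.mod_eq_of_lt i.2]
  split_ifs
  · field_simp
  · simp

/-! ### Eigenvectors of operators that shift moduli -/

/-- `T` permutes the moduli of the coordinates of a vector by the shift `s`. -/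
def ShiftsModuli {d : ℕ} (T : Matrix (Fin d) (Fin d) ℂ) (s : Fin d) : Prop :=
  ∀ (w : Qudit d) (j : Fin d), ‖(T *ᵥ w) (j + s)‖ = ‖w j‖

lemma ShiftsModuli.mul {d : ℕ} {S T : Matrix (Fin d) (Fin d) ℂ} [NeZero d] {s t : Fin d}
    (hS : ShiftsModuli S s) (hT : ShiftsModuli T t) : ShiftsModuli (S * T) (s + t) := fun w j => by
  rw [← Matrix.mulVec_mulVec, add_comm s t, ← add_assoc, hS, hT]

lemma ShiftsModuli.pow {d : ℕ} [NeZero d] {T : Matrix (Fin d) (Fin d) ℂ} {s : Fin d}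
    (hT : ShiftsModuli T s) (n : ℕ) : ShiftsModuli (T ^ n) (n • s) := by
  induction n with
  | zero => intro w j; simp
  | succ n ih => rw [pow_succ, succ_nsmul]; exact ih.mul hT

lemma shiftsModuli_ditterObs {d : ℕ} [NeZero d] {Θ : Fin d → ℂ} (hΘ : IsPhaseTuple Θ) :
    ShiftsModuli (ditterObs Θ) 1 := fun w j => by
  have hval : ((j + 1 : Fin d) : ℕ) = ((j : ℕ) + 1) % d := by
    rw [Fin.val_add, Fin.val_one', Nat.add_mod_mod]
  rw [Matrix.mulVec, dotProduct, Finset.sum_eq_single j]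
  · rw [ditterObs_apply (NeZero.ne d), if_pos hval.symm, norm_mul, norm_mul, norm_star, hΘ, hΘ]
    simp
  · intro k _ hk
    rw [ditterObs_apply (NeZero.ne d), if_neg, zero_mul]
    intro h
    apply hk
    have : k + 1 = j + 1 := by
      apply Fin.ext
      rw [← h, Fin.val_add, Fin.val_one', Nat.add_mod_mod]
    exact add_right_cancel this
  · simp

/-- Each of the `d - 1` factors shifts by one, and `d - 1 = -1` modulo `d`. The product need not be
a ditter observable, but its effect on moduli is all that matters. -/
lemma shiftsModuli_productObs {d : ℕ} [NeZero d] {θ : ℂ} (hθ : ‖θ‖ = 1) {a : ℕ} (ha : a < d) :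
    ShiftsModuli (productObs d θ a) (-1) := by
  have h := ((shiftsModuli_ditterObs (isPhaseTuple_geomPhases d hθ 0)).pow (d - 1 - a)).mul
    ((shiftsModuli_ditterObs (isPhaseTuple_geomPhases d hθ 1)).pow a)
  rw [← add_nsmul] at h
  have hs : (d - 1 - a + a) • (1 : Fin d) = -1 := by
    rw [eq_neg_iff_add_eq_zero, ← succ_nsmul, show d - 1 - a + a + 1 = d by omega]
    simpa using card_nsmul_eq_zero (x := (1 : Fin d))
  rwa [hs] at h

lemma eq_of_add_one_eq {d : ℕ} [NeZero d] {α : Type*} {f : Fin d → α}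
    (h : ∀ j, f (j + 1) = f j) (i j : Fin d) : f i = f j := by
  have key : ∀ n (hn : n < d), f ⟨n, hn⟩ = f 0 := by
    intro n
    induction n with
    | zero => intro hn; rfl
    | succ n ih =>
      intro hn
      rw [← ih (by omega), ← h ⟨n, by omega⟩]
      congr 1
      apply Fin.ext
      rw [Fin.val_add, Fin.val_one', Nat.add_mod_mod]
      exact (Nat.mod_eq_of_lt hn).symm
  rw [key i i.2, key j j.2]

/-- An orthonormal basis of vectors with all coordinates of modulus `1 / √d`. -/
structure IsUnbiased {d : ℕ} (e : Fin d → Qudit d) : Prop where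
  orthonormal : ∀ k l, star (e k) ⬝ᵥ e l = if k = l then 1 else 0
  mul_star : ∀ k j, e k j * star (e k j) = (d : ℂ)⁻¹

/-- Comparing norms in the eigenvalue equation gives `‖μ‖ = 1`. The moduli of an eigenvector are
then invariant under a generator of the cyclic group, hence constant, and normalization fixes the
constant. -/
lemma isUnbiased_of_shiftsModuli {d : ℕ} [NeZero d] {T : Matrix (Fin d) (Fin d) ℂ}
    (hT : ShiftsModuli T 1 ∨ ShiftsModuli T (-1)) {e : Fin d → Qudit d}
    (he : IsMeasurementBasis T e) : IsUnbiased e := by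
  refine ⟨he.1, fun k => ?_⟩
  obtain ⟨μ, hμ⟩ := he.2 k
  have hsum : ∑ j, ‖e k j‖ ^ 2 = 1 := by
    have h := he.1 k k
    rw [if_pos rfl, dotProduct] at h
    have h2 : ((∑ j, ‖e k j‖ ^ 2 : ℝ) : ℂ) = 1 := by
      rw [← h]
      push_cast
      exact Finset.sum_congr rfl fun j _ => by
        rw [Pi.star_apply, Complex.star_def, Complex.conj_mul']
    exact_mod_cast h2
  have key : ∀ s, ShiftsModuli T s → ∀ j, ‖e k (j + s)‖ = ‖e k j‖ := by
    intro s hs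
    have h1 : ∀ j, ‖μ‖ * ‖e k (j + s)‖ = ‖e k j‖ := fun j => by
      rw [← hs (e k) j, hμ, Pi.smul_apply, norm_smul]
    have hμ1 : ‖μ‖ ^ 2 = 1 := by
      have h2 : ∑ j, ‖e k (j + s)‖ ^ 2 = 1 := by
        rw [← hsum]
        exact Fintype.sum_equiv (Equiv.addRight s) _ _ fun j => rfl
      calc ‖μ‖ ^ 2 = ‖μ‖ ^ 2 * ∑ j, ‖e k (j + s)‖ ^ 2 := by rw [h2, mul_one]
        _ = ∑ j, ‖e k j‖ ^ 2 := by
          rw [Finset.mul_sum]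
          exact Finset.sum_congr rfl fun j _ => by rw [← h1 j, mul_pow]
        _ = 1 := hsum
    have hμ2 : ‖μ‖ = 1 := by
      exact (pow_eq_one_iff_of_nonneg (norm_nonneg μ) two_ne_zero).1 hμ1
    intro j
    rw [← h1 j, hμ2, one_mul]
  have hconst : ∀ i j, ‖e k i‖ = ‖e k j‖ := by
    rcases hT with h | h
    · exact eq_of_add_one_eq (key _ h)
    · refine eq_of_add_one_eq (f := fun j => ‖e k j‖) fun j => ?_
      have := key _ h (j + 1)
      rw [add_neg_cancel_right] at this
      exact this.symm
  intro j
  have h3 : (d : ℝ) * ‖e k j‖ ^ 2 = 1 := by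
    rw [← hsum, Finset.sum_congr rfl fun i _ => by rw [hconst i j]]
    simp
  rw [Complex.star_def, Complex.mul_conj']
  exact eq_inv_of_mul_eq_one_right (by exact_mod_cast h3)

lemma isUnbiased_of_mem_ditterBases {d : ℕ} [NeZero d] {e : Fin d → Qudit d}
    (he : e ∈ ditterBases d) : IsUnbiased e := by
  obtain ⟨Θ, hΘ, he⟩ := he
  exact isUnbiased_of_shiftsModuli (.inl (shiftsModuli_ditterObs hΘ)) he

lemma norm_inv_eq_one {θ : ℂ} (hθ : ‖θ‖ = 1) : ‖θ⁻¹‖ = 1 := by rw [norm_inv, hθ, inv_one]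

lemma ndebBases_subset_ditterBases {d : ℕ} {θ : ℂ} (hθ : ‖θ‖ = 1) :
    ndebBases d θ ⊆ ditterBases d := by
  rintro e ⟨a, -, he | he⟩
  · exact ⟨_, isPhaseTuple_geomPhases d hθ a, he⟩
  · exact ⟨_, isPhaseTuple_geomPhases d (norm_inv_eq_one hθ) a, he⟩

lemma ndebBases_nonempty {d : ℕ} [NeZero d] {θ : ℂ} (hθ : ‖θ‖ = 1) : (ndebBases d θ).Nonempty :=
  ⟨_, 0, by norm_num,
    .inl (isMeasurementBasis_ditterObs (NeZero.ne d) (isPhaseTuple_geomPhases d hθ 0))⟩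

lemma isUnbiased_of_mem_hddebBases {d : ℕ} [NeZero d] {θ : ℂ} (hθ : ‖θ‖ = 1)
    {e : Fin d → Qudit d} (he : e ∈ hddebBases d θ) : IsUnbiased e := by
  have hθ' := norm_inv_eq_one hθ
  obtain ⟨a, ha, (he | he) | (he | he)⟩ := he
  · exact isUnbiased_of_shiftsModuli (.inr (shiftsModuli_productObs hθ ha)) he
  · exact isUnbiased_of_shiftsModuli
      (.inl (shiftsModuli_ditterObs (isPhaseTuple_geomPhases d hθ a))) he
  · exact isUnbiased_of_shiftsModuli (.inr (shiftsModuli_productObs hθ' ha)) he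
  · exact isUnbiased_of_shiftsModuli
      (.inl (shiftsModuli_ditterObs (isPhaseTuple_geomPhases d hθ' a))) he

lemma IsUnbiased.isPhaseState {d : ℕ} [NeZero d] {e : Fin d → Qudit d} (he : IsUnbiased e)
    (k : Fin d) : IsPhaseState (e k) := by
  refine ⟨fun j => (e k j).arg, fun j => ?_⟩
  have hd : (0 : ℝ) < d := Nat.cast_pos.2 (Nat.pos_of_ne_zero (NeZero.ne d))
  have h1 : ‖e k j‖ ^ 2 = (d : ℝ)⁻¹ := by
    have := he.mul_star k j
    rw [Complex.star_def, Complex.mul_conj'] at this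
    exact Complex.ofReal_injective (by push_cast; exact this)
  have h2 : ‖e k j‖ = (Real.sqrt d)⁻¹ := by
    rw [← Real.sqrt_inv, ← h1, Real.sqrt_sq (norm_nonneg _)]
  conv_lhs => rw [← Complex.norm_mul_exp_arg_mul_I (e k j), h2]
  rw [mul_comm Complex.I]
  push_cast
  rfl

/-! ### The structure of phase-covariant cloners -/

/-- The machine `β ∑ |i,j,j⟩⟨i| + γ ∑ |j,i,j⟩⟨i| + κ ∑ |i,i,i⟩⟨i|`. -/
def diagonalMachine (d : ℕ) (β γ κ : ℂ) : Machine d :=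
  Matrix.of fun s i =>
    (if s.1 = i then if s.2.1 = s.2.2 then β else 0 else 0) +
    (if s.2.1 = i then if s.1 = s.2.2 then γ else 0 else 0) +
    (if s.1 = i then if s.2.1 = i then if s.2.2 = i then κ else 0 else 0 else 0)

lemma mul_phasePerm_apply {d : ℕ} (V : Machine d) (γ : Fin d → ℝ) (σ : Equiv.Perm (Fin d))
    (s : Fin d × Fin d × Fin d) (j : Fin d) :
    (V * phasePerm γ σ) s (σ j) = V s j * Complex.exp (Complex.I * γ j) := by
  rw [Matrix.mul_apply, Finset.sum_eq_single j]
  · simp [phasePerm]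
  · intro k _ hk
    simp [phasePerm, hk.symm]
  · simp

lemma kronecker_phasePerm_mul_apply {d : ℕ} (V : Machine d) (γ : Fin d → ℝ)
    (σ : Equiv.Perm (Fin d)) (a b c i : Fin d) :
    ((phasePerm γ σ ⊗ₖ (phasePerm γ σ ⊗ₖ (phasePerm γ σ).map star)) * V) (a, (b, c)) i =
      Complex.exp (Complex.I * γ a) * (Complex.exp (Complex.I * γ b) *
        star (Complex.exp (Complex.I * γ c))) * V (σ a, (σ b, σ c)) i := by
  rw [Matrix.mul_apply, Finset.sum_eq_single (σ a, (σ b, σ c))]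
  · simp [phasePerm, Matrix.kroneckerMap_apply]
  · rintro ⟨a', b', c'⟩ - hne
    by_cases ha : a' = σ a
    · by_cases hb : b' = σ b
      · have hc : c' ≠ σ c := fun h => hne (by rw [ha, hb, h])
        simp [phasePerm, Matrix.kroneckerMap_apply, hc]
      · simp [phasePerm, Matrix.kroneckerMap_apply, hb]
    · simp [phasePerm, Matrix.kroneckerMap_apply, ha]
  · simp

lemma covariant_iff {d : ℕ} (V : Machine d) :
    (∀ (γ : Fin d → ℝ) (σ : Equiv.Perm (Fin d)), V * phasePerm γ σ =
        (phasePerm γ σ ⊗ₖ (phasePerm γ σ ⊗ₖ (phasePerm γ σ).map star)) * V) ↔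
      ∀ (γ : Fin d → ℝ) (σ : Equiv.Perm (Fin d)) (a b c j : Fin d),
        V (a, (b, c)) j * Complex.exp (Complex.I * γ j) =
          Complex.exp (Complex.I * γ a) * (Complex.exp (Complex.I * γ b) *
            star (Complex.exp (Complex.I * γ c))) * V (σ a, (σ b, σ c)) (σ j) := by
  constructor
  · intro h γ σ a b c j
    rw [← kronecker_phasePerm_mul_apply, ← h, mul_phasePerm_apply]
  · intro h γ σ
    ext ⟨a, b, c⟩ i
    obtain ⟨j, rfl⟩ := σ.surjective i
    rw [kronecker_phasePerm_mul_apply, mul_phasePerm_apply, h γ σ]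

lemma exp_mul_star_exp (t : ℝ) :
    Complex.exp (Complex.I * t) * star (Complex.exp (Complex.I * t)) = 1 := by
  rw [Complex.star_def, Complex.mul_conj', mul_comm, Complex.norm_exp_ofReal_mul_I]
  simp

lemma diagonalMachine_covariant {d : ℕ} (β γ κ : ℂ) (φ : Fin d → ℝ) (σ : Equiv.Perm (Fin d)) :
    diagonalMachine d β γ κ * phasePerm φ σ =
      (phasePerm φ σ ⊗ₖ (phasePerm φ σ ⊗ₖ (phasePerm φ σ).map star)) *
        diagonalMachine d β γ κ := by
  revert φ σ
  rw [covariant_iff]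
  intro φ σ a b c j
  simp only [diagonalMachine, Matrix.of_apply, EmbeddingLike.apply_eq_iff_eq]
  simp only [mul_add, add_mul]
  congr 1
  · congr 1
    · split_ifs with h1 h2
      · subst h1 h2
        linear_combination (-β * Complex.exp (Complex.I * φ a)) * exp_mul_star_exp (φ b)
      all_goals simp
    · split_ifs with h1 h2
      · subst h1 h2
        linear_combination (-γ * Complex.exp (Complex.I * φ b)) * exp_mul_star_exp (φ a)
      all_goals simp
  · split_ifs with h1 h2 h3
    · subst h1 h2 h3
      linear_combination (-κ * Complex.exp (Complex.I * φ c)) * exp_mul_star_exp (φ c)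
    all_goals simp

/-- Double transitivity of the symmetric group: an entry of a covariant machine indexed by two
distinct values can be moved to one fixed representative. -/
lemma exists_perm_apply_eq {α : Type*} [DecidableEq α] {i₀ i₁ i j : α} (h : i₀ ≠ i₁) (hij : i ≠ j) :
    ∃ σ : Equiv.Perm α, σ i₀ = i ∧ σ i₁ = j := by
  refine ⟨Equiv.swap (Equiv.swap i₀ i i₁) j * Equiv.swap i₀ i, ?_, ?_⟩
  · rw [Equiv.Perm.mul_apply, Equiv.swap_apply_left]
    refine Equiv.swap_apply_of_ne_of_ne ?_ hij
    intro h'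
    apply h
    apply (Equiv.swap i₀ i).injective
    rw [Equiv.swap_apply_left, ← h']
  · rw [Equiv.Perm.mul_apply, Equiv.swap_apply_left]

lemma IsPhaseCovariantCloner.apply_perm {d : ℕ} {V : Machine d} (hV : IsPhaseCovariantCloner V)
    (σ : Equiv.Perm (Fin d)) (a b c j : Fin d) :
    V (σ a, (σ b, σ c)) (σ j) = V (a, (b, c)) j := by
  have := (covariant_iff V).1 hV.covariant 0 σ a b c j
  simpa using this.symm

lemma exp_I_ite (p : Prop) [Decidable p] :
    Complex.exp (Complex.I * ((if p then Real.pi / 2 else 0 : ℝ) : ℂ)) =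
      if p then Complex.I else 1 := by
  split_ifs
  · rw [mul_comm]
    push_cast
    exact Complex.exp_pi_div_two_mul_I
  · simp

/-- A diagonal unitary multiplies the entry by the phase of `γ a + γ b - γ c - γ j`, so the entry
survives only if `{a, b}` and `{c, j}` agree as multisets. -/
lemma IsPhaseCovariantCloner.apply_eq_zero {d : ℕ} {V : Machine d}
    (hV : IsPhaseCovariantCloner V) {a b c j : Fin d} (h1 : ¬(a = j ∧ b = c))
    (h2 : ¬(b = j ∧ a = c)) : V (a, (b, c)) j = 0 := by
  have key : ∀ t, V (a, (b, c)) j * (if j = t then Complex.I else 1) =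
      (if a = t then Complex.I else 1) * ((if b = t then Complex.I else 1) *
        star (if c = t then Complex.I else 1)) * V (a, (b, c)) j := fun t => by
    have := (covariant_iff V).1 hV.covariant (fun i => if i = t then Real.pi / 2 else 0) 1 a b c j
    simp only [exp_I_ite] at this
    simpa using this
  -- A quarter turn at one index suffices: the exponents lie between `-2` and `2`, and `Complex.I ^
  -- n ≠ 1` for nonzero `n` in that range. The turn at `j` is inconclusive when exactly one of `a`,
  -- `b` is `j` and `c` is not; then the turn at `c` decides.
  have kj := key j
  have kc := key c
  generalize V (a, (b, c)) j = z at kj kc ⊢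
  have hre := congrArg Complex.re kj
  have him := congrArg Complex.im kj
  have hre' := congrArg Complex.re kc
  have him' := congrArg Complex.im kc
  by_cases ha : a = j <;> by_cases hb : b = j <;> by_cases hc : c = j
  · exact absurd ⟨ha, hb.trans hc.symm⟩ h1
  · simp [ha, hb, hc] at hre him
    exact Complex.ext (by simp; linarith) (by simp; linarith)
  · simp [ha, hb, hc] at hre him
    exact Complex.ext (by simp; linarith) (by simp; linarith)
  · have hbc : b ≠ c := fun h => h1 ⟨ha, h⟩
    simp [ha, hbc, Ne.symm hc] at hre' him'
    exact Complex.ext (by simp; linarith) (by simp; linarith)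
  · simp [ha, hb, hc] at hre him
    exact Complex.ext (by simp; linarith) (by simp; linarith)
  · have hac : a ≠ c := fun h => h2 ⟨hb, h⟩
    simp [hb, hac, Ne.symm hc] at hre' him'
    exact Complex.ext (by simp; linarith) (by simp; linarith)
  · simp [ha, hb, hc] at hre him
    exact Complex.ext (by simp; linarith) (by simp; linarith)
  · simp [ha, hb, hc] at hre him
    exact Complex.ext (by simp; linarith) (by simp; linarith)

lemma IsPhaseCovariantCloner.exists_eq_diagonalMachine {d : ℕ} (hd : 2 ≤ d) {V : Machine d}
    (hV : IsPhaseCovariantCloner V) : ∃ β γ κ : ℂ, V = diagonalMachine d β γ κ := by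
  let i₀ : Fin d := ⟨0, by omega⟩
  let i₁ : Fin d := ⟨1, by omega⟩
  have h01 : i₀ ≠ i₁ := by simp [i₀, i₁]
  -- One representative for each orbit of admissible entries. On the fully coincident entry all
  -- three terms overlap, so the first two are subtracted.
  refine ⟨V (i₀, (i₁, i₁)) i₀, V (i₁, (i₀, i₁)) i₀,
    V (i₀, (i₀, i₀)) i₀ - V (i₀, (i₁, i₁)) i₀ - V (i₁, (i₀, i₁)) i₀, ?_⟩
  ext ⟨a, b, c⟩ i
  simp only [diagonalMachine, Matrix.of_apply]
  by_cases h1 : a = i ∧ b = c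
  · obtain ⟨rfl, rfl⟩ := h1
    by_cases hab : b = a
    · subst hab
      have := hV.apply_perm (Equiv.swap i₀ b) i₀ i₀ i₀ i₀
      rw [Equiv.swap_apply_left] at this
      simp [this]
    · obtain ⟨σ, rfl, rfl⟩ := exists_perm_apply_eq h01 (Ne.symm hab)
      rw [hV.apply_perm]
      simp [h01.symm]
  · by_cases h2 : b = i ∧ a = c
    · obtain ⟨rfl, rfl⟩ := h2
      have hab : b ≠ a := fun h => h1 ⟨h.symm, h⟩
      obtain ⟨σ, rfl, rfl⟩ := exists_perm_apply_eq h01 hab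
      rw [hV.apply_perm]
      simp [h01.symm]
    · rw [hV.apply_eq_zero h1 h2]
      split_ifs <;> simp_all

/-! ### Amplitudes of phase-covariant cloners -/

/-- The phase-covariant machine with complex amplitudes `v`, `x`, `y`. -/
def complexCloner (d : ℕ) (v x y : ℂ) : Machine d :=
  diagonalMachine d ((v - x) * ((Real.sqrt d : ℝ) : ℂ)⁻¹) (((Real.sqrt d : ℝ) : ℂ) * y)
    (((Real.sqrt d : ℝ) : ℂ) * (x - y))

lemma ofReal_sqrt_ne_zero (d : ℕ) [NeZero d] : ((Real.sqrt d : ℝ) : ℂ) ≠ 0 := by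
  have hd : (0 : ℝ) < d := Nat.cast_pos.2 (Nat.pos_of_ne_zero (NeZero.ne d))
  exact_mod_cast (Real.sqrt_pos.2 hd).ne'

lemma IsPhaseCovariantCloner.exists_eq_complexCloner {d : ℕ} (hd : 2 ≤ d) {V : Machine d}
    (hV : IsPhaseCovariantCloner V) : ∃ v x y : ℂ, V = complexCloner d v x y := by
  have : NeZero d := ⟨by omega⟩
  obtain ⟨β, γ, κ, rfl⟩ := hV.exists_eq_diagonalMachine hd
  have hr := ofReal_sqrt_ne_zero d
  refine ⟨((Real.sqrt d : ℝ) : ℂ) * β + (κ + γ) * ((Real.sqrt d : ℝ) : ℂ)⁻¹,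
    (κ + γ) * ((Real.sqrt d : ℝ) : ℂ)⁻¹, γ * ((Real.sqrt d : ℝ) : ℂ)⁻¹, ?_⟩
  rw [complexCloner]
  congr 1
  · field_simp
    ring
  · field_simp
  · field_simp
    ring

lemma diagonalMachine_conjTranspose_mul_self (d : ℕ) (β γ κ : ℂ) :
    (diagonalMachine d β γ κ)ᴴ * diagonalMachine d β γ κ =
      (d * (β * star β) + d * (γ * star γ) + κ * star κ + β * star γ + γ * star β +
        (β + γ) * star κ + κ * star (β + γ)) • (1 : Matrix (Fin d) (Fin d) ℂ) := by
  ext i j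
  rw [Matrix.mul_apply, Matrix.smul_apply, Matrix.one_apply]
  simp only [Matrix.conjTranspose_apply, diagonalMachine, Matrix.of_apply, Fintype.sum_prod_type]
  simp only [star_add, apply_ite star, star_zero, mul_add, add_mul, Finset.sum_add_distrib, mul_ite,
    ite_mul, mul_zero, zero_mul]
  simp [Finset.sum_ite_irrel]
  by_cases h : j = i
  · subst h
    simp [Finset.sum_add_distrib]
    ring
  · simp [h, Ne.symm h]

/-- The change of variables diagonalizes the norm form; the weights `1`, `d - 1`, `d * (d - 1)`
count the entries `v`, `x`, `y` of the amplitude matrix. -/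
lemma complexCloner_conjTranspose_mul_self (d : ℕ) [NeZero d] (v x y : ℂ) :
    (complexCloner d v x y)ᴴ * complexCloner d v x y =
      ((‖v‖ ^ 2 + (d - 1) * ‖x‖ ^ 2 + d * (d - 1) * ‖y‖ ^ 2 : ℝ) : ℂ) •
        (1 : Matrix (Fin d) (Fin d) ℂ) := by
  have hr := ofReal_sqrt_ne_zero d
  have hd := ofReal_sqrt_mul_self d
  rw [complexCloner, diagonalMachine_conjTranspose_mul_self]
  congr 1
  push_cast
  rw [← Complex.mul_conj', ← Complex.mul_conj', ← Complex.mul_conj']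
  simp only [star_add, star_sub, star_mul', star_inv₀, Complex.star_def, Complex.conj_ofReal]
  rw [← hd]
  field_simp
  ring

lemma isPhaseCovariantCloner_complexCloner {d : ℕ} [NeZero d] {v x y : ℂ} :
    IsPhaseCovariantCloner (complexCloner d v x y) ↔
      ‖v‖ ^ 2 + (d - 1) * ‖x‖ ^ 2 + d * (d - 1) * ‖y‖ ^ 2 = 1 := by
  constructor
  · intro h
    have h1 := congrFun (congrFun ((complexCloner_conjTranspose_mul_self d v x y).symm.trans
      h.isometry) 0) 0
    rw [Matrix.smul_apply, Matrix.one_apply_eq, smul_eq_mul, mul_one] at h1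
    exact_mod_cast h1
  · intro h
    refine ⟨?_, fun φ σ => diagonalMachine_covariant _ _ _ φ σ⟩
    rw [complexCloner_conjTranspose_mul_self, h, Complex.ofReal_one, one_smul]

lemma bellCloner_eq_complexCloner (d : ℕ) [NeZero d] (v x y : ℝ) :
    bellCloner d v x y = complexCloner d v x y := by
  have hr := ofReal_sqrt_ne_zero d
  have hd := ofReal_sqrt_mul_self d
  have hmod : ∀ a i m : Fin d, (a : ℕ) = ((i : ℕ) + (m : ℕ)) % d ↔ m = a - i := fun a i m => by
    rw [← Fin.val_add, ← Fin.ext_iff, eq_sub_iff_add_eq, add_comm m, eq_comm]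
  have hval : ∀ m : Fin d, (m : ℕ) = 0 ↔ m = 0 := fun m => Fin.val_eq_zero_iff
  -- A Fourier sum over `n`: the part of the amplitude constant in `n` forces `i = b`, while the
  -- spike at `m = n = 0` imposes no relation between `i` and `b`.
  have hsum : ∀ i b m : Fin d, ∑ n : Fin d, (amplitude v x y m n : ℂ) *
      (omega d ^ ((i : ℕ) * (n : ℕ)) * star (omega d ^ ((b : ℕ) * (n : ℕ)))) =
      (if m = 0 then (v - x : ℂ) + (if i = b then d * (x - y : ℂ) else 0) else 0) +
        (if i = b then d * (y : ℂ) else 0) := by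
    intro i b m
    have hamp : ∀ n, (amplitude v x y m n : ℂ) =
        (if m = 0 then (if n = 0 then (v - x : ℂ) else 0) + (x - y) else 0) + y := fun n => by
      simp only [amplitude, hval]
      split_ifs <;> ring
    have hω : ∑ n : Fin d, omega d ^ ((i : ℕ) * (n : ℕ)) * star (omega d ^ ((b : ℕ) * (n : ℕ))) =
        if i = b then (d : ℂ) else 0 := by
      have := sum_omega_pow_mul_star (NeZero.ne d) i b
      rw [Nat.mod_eq_of_lt i.2, Nat.mod_eq_of_lt b.2] at this
      simp only [Fin.ext_iff]
      rw [← this]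
      exact Finset.sum_congr rfl fun n _ => by rw [mul_comm (n : ℕ), mul_comm (n : ℕ)]
    simp only [hamp]
    by_cases hm : m = 0
    · simp only [hm, if_true, add_mul, Finset.sum_add_distrib, ite_mul, zero_mul, ← Finset.mul_sum,
        hω]
      rw [Finset.sum_ite_eq' Finset.univ (0 : Fin d), if_pos (Finset.mem_univ _)]
      simp only [(hval 0).2 rfl, mul_zero, pow_zero, star_one, mul_one]
      split_ifs <;> ring
    · simp only [hm, if_false, zero_add, ← Finset.mul_sum, hω]
      split_ifs <;> ring
  ext ⟨a, b, c⟩ i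
  have hterm : ∀ m : Fin d, ∑ n : Fin d, (amplitude v x y m n : ℂ) * errorOp m n a i *
      bellState m n (b, c) = if m = a - i then if m = c - b then
        ((Real.sqrt d : ℝ) : ℂ)⁻¹ * ((if m = 0 then (v - x : ℂ) +
          (if i = b then d * (x - y : ℂ) else 0) else 0) + (if i = b then d * (y : ℂ) else 0))
        else 0 else 0 := by
    intro m
    simp only [errorOp, bellState, Matrix.of_apply, hmod]
    by_cases h1 : m = a - i
    · by_cases h2 : m = c - b
      · rw [if_pos h1, if_pos h2, ← hsum, Finset.mul_sum]
        refine Finset.sum_congr rfl fun n _ => ?_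
        rw [if_pos h1, if_pos h2]
        ring
      · simp [h2]
    · simp [h1]
  simp only [bellCloner, Matrix.of_apply, hterm]
  rw [Finset.sum_ite_eq' Finset.univ (a - i), if_pos (Finset.mem_univ _)]
  simp only [complexCloner, diagonalMachine, Matrix.of_apply, sub_eq_zero]
  rw [← hd]
  by_cases hib : i = b
  · subst hib
    by_cases hai : a = i
    · subst hai
      by_cases hac : a = c
      · subst hac
        simp
        field_simp
        ring
      · have : (0 : Fin d) ≠ c - a := fun h => hac (sub_eq_zero.1 h.symm).symm
        simp [hac, this, Ne.symm hac]
    · by_cases hac : a = c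
      · subst hac
        simp [hai]
        field_simp
      · simp [hai, hac]
  · by_cases hai : a = i
    · by_cases hbc : b = c
      · have hic : i ≠ c := fun h => hib (h.trans hbc.symm)
        simp [hai, hbc, hic, hic.symm]
        ring
      · have hcb : 0 ≠ c - b := fun h => hbc (sub_eq_zero.1 h.symm).symm
        simp [hai, hbc, hcb, Ne.symm hib]
    · simp [hai, hib, Ne.symm hib]

/-! ### Outcome probabilities in unbiased bases -/

lemma diagonalMachine_mulVec (d : ℕ) (β γ κ : ℂ) (ψ : Qudit d) (a b c : Fin d) :
    (diagonalMachine d β γ κ *ᵥ ψ) (a, (b, c)) =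
      (if b = c then β * ψ a else 0) + (if a = c then γ * ψ b else 0) +
        (if b = a then if c = a then κ * ψ a else 0 else 0) := by
  simp only [Matrix.mulVec, dotProduct, diagonalMachine, Matrix.of_apply, add_mul, ite_mul,
    zero_mul, Finset.sum_add_distrib]
  simp

lemma ofReal_cloneProb {d : ℕ} (V : Machine d) (ψ φ : Qudit d) :
    (cloneProb V ψ φ : ℂ) = ∑ b, ∑ c, (∑ a, star (φ a) * (V *ᵥ ψ) (a, (b, c))) *
      star (∑ a, star (φ a) * (V *ᵥ ψ) (a, (b, c))) := by
  have key : star φ ⬝ᵥ (cloneDensity V ψ *ᵥ φ) =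
      ∑ b, ∑ c, (∑ a, star (φ a) * (V *ᵥ ψ) (a, (b, c))) *
        star (∑ a, star (φ a) * (V *ᵥ ψ) (a, (b, c))) := by
    rw [← Fintype.sum_prod_type' (fun b c => (∑ a, star (φ a) * (V *ᵥ ψ) (a, (b, c))) *
        star (∑ a, star (φ a) * (V *ᵥ ψ) (a, (b, c))))]
    have hdens : ∀ i, (cloneDensity V ψ *ᵥ φ) i =
        ∑ j, (∑ s, (V *ᵥ ψ) (i, s) * star ((V *ᵥ ψ) (j, s))) * φ j := fun _ => rfl
    simp only [dotProduct, hdens, Finset.mul_sum,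
      Finset.sum_mul, star_sum, Pi.star_apply, star_mul', star_star]
    rw [Finset.sum_congr rfl fun i _ => Finset.sum_comm, Finset.sum_comm]
    refine Finset.sum_congr rfl fun s _ => ?_
    rw [Finset.sum_comm]
    refine Finset.sum_congr rfl fun i _ => Finset.sum_congr rfl fun j _ => ?_
    ring
  rw [cloneProb, key]
  simp only [Complex.star_def, Complex.mul_conj']
  norm_cast

lemma ofReal_adversaryProb {d : ℕ} (V : Machine d) (ψ φ χ : Qudit d) :
    (adversaryProb V ψ φ χ : ℂ) =
      ∑ a, (∑ b, ∑ c, star (φ b) * χ c * (V *ᵥ ψ) (a, (b, c))) *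
        star (∑ b, ∑ c, star (φ b) * χ c * (V *ᵥ ψ) (a, (b, c))) := by
  rw [adversaryProb]
  push_cast
  refine Finset.sum_congr rfl fun a _ => ?_
  rw [← Complex.mul_conj', Fintype.sum_prod_type]
  rfl

lemma sum_mul_diagonalMachine_mulVec (d : ℕ) (β γ κ : ℂ) (ψ φ : Qudit d) (b c : Fin d) :
    ∑ a, star (φ a) * (diagonalMachine d β γ κ *ᵥ ψ) (a, (b, c)) =
      (if b = c then β * (star φ ⬝ᵥ ψ) + κ * (star (φ b) * ψ b) else 0) +
        γ * (star (φ c) * ψ b) := by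
  simp only [diagonalMachine_mulVec, mul_add, mul_ite, mul_zero, Finset.sum_add_distrib]
  by_cases h : b = c
  · subst h
    simp [dotProduct, Finset.mul_sum]
    rw [Finset.sum_congr rfl fun a _ => mul_left_comm _ _ _]
    ring
  · simp [h, Ne.symm h]
    ring

lemma sum_mul_mul_diagonalMachine_mulVec (d : ℕ) (β γ κ : ℂ) (ψ φ χ : Qudit d) (a : Fin d) :
    ∑ b, ∑ c, star (φ b) * χ c * (diagonalMachine d β γ κ *ᵥ ψ) (a, (b, c)) =
      β * (star φ ⬝ᵥ χ) * ψ a + γ * (star φ ⬝ᵥ ψ) * χ a + κ * (star (φ a) * χ a * ψ a) := by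
  simp only [diagonalMachine_mulVec, mul_add, mul_ite, mul_zero, Finset.sum_add_distrib]
  simp [dotProduct, Finset.mul_sum, Finset.sum_mul, Finset.sum_ite_irrel]
  congr 1
  · congr 1 <;> refine Finset.sum_congr rfl fun b _ => ?_ <;> ring
  · ring

lemma sum_ite_add_mul_star {d : ℕ} (γ : ℂ) (X : Fin d → ℂ) (ψ φ : Qudit d) :
    ∑ b, ∑ c, ((if b = c then X b else 0) + γ * (star (φ c) * ψ b)) *
        star ((if b = c then X b else 0) + γ * (star (φ c) * ψ b)) =
      ∑ b, (X b * star (X b) + X b * star (γ * (star (φ b) * ψ b)) +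
          γ * (star (φ b) * ψ b) * star (X b)) +
        γ * star γ * ((star φ ⬝ᵥ φ) * (star ψ ⬝ᵥ ψ)) := by
  simp only [star_add, apply_ite star, star_zero, mul_add, add_mul, mul_ite, ite_mul, mul_zero,
    zero_mul, Finset.sum_add_distrib]
  simp [dotProduct, Finset.mul_sum, Finset.sum_mul]
  have key : ∑ b, ∑ c, γ * (star (φ c) * ψ b) * (star γ * (φ c * star (ψ b))) =
      ∑ b, ∑ c, γ * star γ * (star (φ c) * φ c * (star (ψ b) * ψ b)) :=
    Finset.sum_congr rfl fun i _ => Finset.sum_congr rfl fun j _ => by ring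
  simp only [Complex.star_def] at key
  simp only [key, Finset.sum_add_distrib]
  ring

lemma IsUnbiased.ofReal_cloneProb {d : ℕ} {e : Fin d → Qudit d} (he : IsUnbiased e)
    (β γ κ : ℂ) (k l : Fin d) :
    (cloneProb (diagonalMachine d β γ κ) (e k) (e l) : ℂ) =
      ∑ b, (((if l = k then β else 0) + κ * (star (e l b) * e k b)) *
          star ((if l = k then β else 0) + κ * (star (e l b) * e k b)) +
        ((if l = k then β else 0) + κ * (star (e l b) * e k b)) *
          star (γ * (star (e l b) * e k b)) +
        γ * (star (e l b) * e k b) *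
          star ((if l = k then β else 0) + κ * (star (e l b) * e k b))) + γ * star γ := by
  rw [QuditCloning.ofReal_cloneProb]
  simp only [sum_mul_diagonalMachine_mulVec, he.orthonormal, mul_ite, mul_one, mul_zero]
  rw [sum_ite_add_mul_star γ (fun b => (if l = k then β else 0) + κ * (star (e l b) * e k b)),
    he.orthonormal, he.orthonormal, if_pos rfl, if_pos rfl, mul_one, mul_one]

lemma IsUnbiased.star_mul {d : ℕ} {e : Fin d → Qudit d} (he : IsUnbiased e) (k j : Fin d) :
    star (e k j) * e k j = (d : ℂ)⁻¹ := by
  rw [mul_comm, he.mul_star]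

lemma IsUnbiased.cloneProb_self {d : ℕ} [NeZero d] {e : Fin d → Qudit d} (he : IsUnbiased e)
    (v x y : ℂ) (k : Fin d) :
    cloneProb (complexCloner d v x y) (e k) (e k) = ‖v‖ ^ 2 + (d - 1) * ‖y‖ ^ 2 := by
  have hr := ofReal_sqrt_ne_zero d
  have hd := ofReal_sqrt_mul_self d
  apply Complex.ofReal_injective
  rw [complexCloner, he.ofReal_cloneProb]
  simp only [he.star_mul, if_true, Finset.sum_const, Finset.card_univ, Fintype.card_fin,
    nsmul_eq_mul]
  push_cast
  rw [← Complex.mul_conj', ← Complex.mul_conj']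
  simp only [star_add, star_sub, star_mul', star_inv₀, Complex.star_def, Complex.conj_ofReal,
    Complex.conj_natCast]
  rw [← hd]
  field_simp
  ring

/-- Orthogonality removes the `β` terms. What is left involves `star (e l b) * e k b` only through
its modulus, which unbiasedness fixes. -/
lemma IsUnbiased.cloneProb_of_ne {d : ℕ} [NeZero d] {e : Fin d → Qudit d} (he : IsUnbiased e)
    (v x y : ℂ) {k l : Fin d} (hkl : k ≠ l) :
    cloneProb (complexCloner d v x y) (e k) (e l) = ‖x‖ ^ 2 + (d - 1) * ‖y‖ ^ 2 := by
  have hr := ofReal_sqrt_ne_zero d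
  have hd := ofReal_sqrt_mul_self d
  apply Complex.ofReal_injective
  rw [complexCloner, he.ofReal_cloneProb]
  simp only [hkl.symm, if_false, zero_add]
  have hterm : ∀ (κ γ : ℂ) (b : Fin d),
      κ * (star (e l b) * e k b) * star (κ * (star (e l b) * e k b)) +
        κ * (star (e l b) * e k b) * star (γ * (star (e l b) * e k b)) +
        γ * (star (e l b) * e k b) * star (κ * (star (e l b) * e k b)) =
      (κ * star κ + κ * star γ + γ * star κ) * ((d : ℂ)⁻¹ * (d : ℂ)⁻¹) := by
    intro κ γ b
    simp only [star_mul', star_star]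
    linear_combination (κ * star κ + κ * star γ + γ * star κ) * (star (e l b) * e l b *
      he.mul_star k b + (d : ℂ)⁻¹ * he.star_mul l b)
  simp only [hterm, Finset.sum_const, Finset.card_univ, Fintype.card_fin, nsmul_eq_mul]
  push_cast
  rw [← Complex.mul_conj', ← Complex.mul_conj']
  simp only [star_sub, star_mul', Complex.star_def, Complex.conj_ofReal]
  rw [← hd]
  field_simp
  ring

/-- The `κ` term is a pointwise product of three basis vectors. If the conjugated one equals
another, their product is the constant `1 / d` and the third remains; otherwise only the `κ` term
survives and its modulus is known. Hence just four values, with `c = k` not singled out. -/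
lemma IsUnbiased.ofReal_adversaryProb {d : ℕ} {e : Fin d → Qudit d} (he : IsUnbiased e)
    (β γ κ : ℂ) (k b c : Fin d) :
    (adversaryProb (diagonalMachine d β γ κ) (e k) (e b) (e c) : ℂ) =
      if b = c then
        if b = k then (β + γ + κ * (d : ℂ)⁻¹) * star (β + γ + κ * (d : ℂ)⁻¹)
        else (β + κ * (d : ℂ)⁻¹) * star (β + κ * (d : ℂ)⁻¹)
      else
        if b = k then (γ + κ * (d : ℂ)⁻¹) * star (γ + κ * (d : ℂ)⁻¹)
        else κ * star κ * ((d : ℂ)⁻¹ * (d : ℂ)⁻¹) := by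
  have hnorm : ∀ (z : ℂ) (k : Fin d), ∑ a, z * e k a * star (z * e k a) = z * star z := by
    intro z k
    have h := he.orthonormal k k
    rw [if_pos rfl, dotProduct] at h
    rw [← mul_one (z * star z), ← h, Finset.mul_sum]
    refine Finset.sum_congr rfl fun a _ => ?_
    rw [star_mul', Pi.star_apply]
    ring
  rw [QuditCloning.ofReal_adversaryProb]
  simp only [sum_mul_mul_diagonalMachine_mulVec, he.orthonormal]
  split_ifs with hbc hbk hbk
  · subst hbc hbk
    rw [← hnorm _ b]
    simp only [he.star_mul, mul_one]
    refine Finset.sum_congr rfl fun a _ => ?_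
    congr 2 <;> ring
  · subst hbc
    rw [← hnorm _ k]
    simp only [he.star_mul, mul_one, mul_zero, zero_mul, add_zero]
    refine Finset.sum_congr rfl fun a _ => ?_
    congr 2 <;> ring
  · subst hbk
    rw [← hnorm _ c]
    simp only [mul_right_comm _ _ (e b _), he.star_mul, mul_one, mul_zero, zero_mul, zero_add]
    refine Finset.sum_congr rfl fun a _ => ?_
    congr 2 <;> ring
  · simp only [mul_zero, zero_mul, zero_add]
    have hterm : ∀ a, κ * (star (e b a) * e c a * e k a) *
        star (κ * (star (e b a) * e c a * e k a)) =
        κ * star κ * ((d : ℂ)⁻¹ * (d : ℂ)⁻¹) * (star (e k a) * e k a) := by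
      intro a
      simp only [star_mul', star_star]
      linear_combination κ * star κ * (star (e k a) * e k a) * (star (e b a) * e b a *
        he.mul_star c a + (d : ℂ)⁻¹ * he.star_mul b a)
    have h := he.orthonormal k k
    rw [if_pos rfl, dotProduct] at h
    simp only [hterm, ← Finset.mul_sum]
    exact (congrArg _ h).trans (mul_one _)

/-- The distribution of the adversary's results, by the coincidences between them and the input. -/
def adversaryPattern {d : ℕ} (g₁ g₂ g₃ g₄ : ℝ) (k : Fin d) (q : Fin d × Fin d) : ℝ :=
  if q.1 = q.2 then if q.1 = k then g₁ else g₂ else if q.1 = k then g₃ else g₄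

lemma IsUnbiased.adversaryProb_eq {d : ℕ} [NeZero d] {e : Fin d → Qudit d} (he : IsUnbiased e)
    (v x y : ℂ) (k : Fin d) (q : Fin d × Fin d) :
    adversaryProb (complexCloner d v x y) (e k) (e q.1) (e q.2) =
      adversaryPattern (‖v + (d - 1) * y‖ ^ 2 / d) (‖v - y‖ ^ 2 / d) (‖x + (d - 1) * y‖ ^ 2 / d)
        (‖x - y‖ ^ 2 / d) k q := by
  have hr := ofReal_sqrt_ne_zero d
  have hd := ofReal_sqrt_mul_self d
  apply Complex.ofReal_injective
  rw [complexCloner, he.ofReal_adversaryProb, adversaryPattern]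
  split_ifs
  all_goals
    push_cast
    rw [← Complex.mul_conj']
    simp only [star_add, star_sub, star_mul', star_inv₀, Complex.star_def, Complex.conj_ofReal,
      Complex.conj_natCast, map_add, map_sub, map_mul, map_one]
    rw [← hd]
    field_simp <;> ring

/-! ### Information in unbiased bases -/

lemma continuous_mutualInfo {X α β : Type*} [TopologicalSpace X] [Fintype α] [Fintype β]
    {P : X → α → β → ℝ} (hP : ∀ a b, Continuous fun t => P t a b) :
    Continuous fun t => mutualInfo (P t) := by
  have h := Real.continuous_negMulLog
  unfold mutualInfo
  refine ((continuous_finsetSum _ fun a _ => h.comp ?_).add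
    (continuous_finsetSum _ fun b _ => h.comp ?_)).sub
    (continuous_finsetSum _ fun a _ => continuous_finsetSum _ fun b _ => h.comp (hP a b))
  · exact continuous_finsetSum _ fun b _ => hP a b
  · exact continuous_finsetSum _ fun a _ => hP a b

lemma sum_ite_eq_add_mul {d : ℕ} (b : Fin d) (A B : ℝ) :
    ∑ c, (if b = c then A else B) = A + (d - 1) * B := by
  have : ∀ c, (if b = c then A else B) = (if b = c then A - B else 0) + B := fun c => by
    split_ifs <;> ring
  simp only [this, Finset.sum_add_distrib, Finset.sum_ite_eq, Finset.mem_univ, if_true]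
  simp
  ring

lemma sum_ite_eq_add_mul' {d : ℕ} (b : Fin d) (A B : ℝ) :
    ∑ c, (if c = b then A else B) = A + (d - 1) * B := by
  simp only [eq_comm (b := b), sum_ite_eq_add_mul]

/-- The receiver's information, as a function of the fidelity and of the probability of each
wrong result. -/
def receiverInfoOf (d : ℕ) (F D : ℝ) : ℝ :=
  mutualInfo fun k l : Fin d => (d : ℝ)⁻¹ * if k = l then F else D

/-- The adversary's information, as a function of the probabilities of `adversaryPattern`. -/
def adversaryInfoOf (d : ℕ) (g₁ g₂ g₃ g₄ : ℝ) : ℝ :=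
  mutualInfo fun (k : Fin d) (q : Fin d × Fin d) => (d : ℝ)⁻¹ * adversaryPattern g₁ g₂ g₃ g₄ k q

/-- The entropy of the adversary's result for a given difference between the results. -/
def branchEntropy (d : ℕ) (a b : ℝ) : ℝ :=
  Real.negMulLog ((d : ℝ)⁻¹ * a) + (d - 1) * Real.negMulLog ((d : ℝ)⁻¹ * b)

lemma adversaryPattern_mk {d : ℕ} (g₁ g₂ g₃ g₄ : ℝ) (k b c : Fin d) :
    adversaryPattern g₁ g₂ g₃ g₄ k (b, c) =
      if b = c then if b = k then g₁ else g₂ else if b = k then g₃ else g₄ := rfl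

/-- This separates what phases can change: the first two terms depend only on the branch totals,
which the moduli of the amplitudes determine, and the phases enter through the last two branch
entropies. -/
lemma adversaryInfoOf_eq (d : ℕ) (g₁ g₂ g₃ g₄ : ℝ) :
    adversaryInfoOf d g₁ g₂ g₃ g₄ =
      d * Real.negMulLog ((d : ℝ)⁻¹ * ((g₁ + (d - 1) * g₂) + (d - 1) * (g₃ + (d - 1) * g₄))) +
      d * branchEntropy d (g₁ + (d - 1) * g₂) (g₃ + (d - 1) * g₄) -
      d * (branchEntropy d g₁ g₂ + (d - 1) * branchEntropy d g₃ g₄) := by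
  have hrow : ∀ k : Fin d, ∑ q, adversaryPattern g₁ g₂ g₃ g₄ k q =
      (g₁ + (d - 1) * g₂) + (d - 1) * (g₃ + (d - 1) * g₄) := by
    intro k
    simp only [Fintype.sum_prod_type, adversaryPattern_mk, sum_ite_eq_add_mul]
    have : ∀ b : Fin d, (if b = k then g₁ else g₂) + (d - 1) * (if b = k then g₃ else g₄) =
        if b = k then g₁ + (d - 1) * g₃ else g₂ + (d - 1) * g₄ := fun b => by
      split_ifs <;> rfl
    simp only [this, sum_ite_eq_add_mul']
    ring
  have hcol : ∀ q : Fin d × Fin d, ∑ k, adversaryPattern g₁ g₂ g₃ g₄ k q =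
      if q.1 = q.2 then g₁ + (d - 1) * g₂ else g₃ + (d - 1) * g₄ := by
    intro q
    simp only [adversaryPattern]
    split_ifs <;> exact sum_ite_eq_add_mul _ _ _
  have hent : ∀ k : Fin d, ∑ q, Real.negMulLog ((d : ℝ)⁻¹ * adversaryPattern g₁ g₂ g₃ g₄ k q) =
      branchEntropy d g₁ g₂ + (d - 1) * branchEntropy d g₃ g₄ := by
    intro k
    simp only [Fintype.sum_prod_type, adversaryPattern_mk, mul_ite, apply_ite Real.negMulLog,
      sum_ite_eq_add_mul]
    have : ∀ b : Fin d, (if b = k then Real.negMulLog ((d : ℝ)⁻¹ * g₁) else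
          Real.negMulLog ((d : ℝ)⁻¹ * g₂)) +
        (if b = k then (d - 1) * Real.negMulLog ((d : ℝ)⁻¹ * g₃) else
          (d - 1) * Real.negMulLog ((d : ℝ)⁻¹ * g₄)) =
        if b = k then Real.negMulLog ((d : ℝ)⁻¹ * g₁) + (d - 1) * Real.negMulLog ((d : ℝ)⁻¹ * g₃)
        else Real.negMulLog ((d : ℝ)⁻¹ * g₂) + (d - 1) * Real.negMulLog ((d : ℝ)⁻¹ * g₄) :=
      fun b => by split_ifs <;> rfl
    simp only [this, sum_ite_eq_add_mul', branchEntropy]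
    ring
  simp only [adversaryInfoOf, mutualInfo, ← Finset.mul_sum, hrow, hcol, hent]
  simp only [Fintype.sum_prod_type, mul_ite, apply_ite Real.negMulLog, sum_ite_eq_add_mul,
    Finset.sum_const, Finset.card_univ, Fintype.card_fin, nsmul_eq_mul, branchEntropy]

/-- The condition on the amplitudes under which the adversary is at least as well informed as the
receiver in every unbiased basis. -/
def BreaksUnbiased (d : ℕ) (v x y : ℂ) : Prop :=
  receiverInfoOf d (‖v‖ ^ 2 + (d - 1) * ‖y‖ ^ 2) (‖x‖ ^ 2 + (d - 1) * ‖y‖ ^ 2) ≤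
    adversaryInfoOf d (‖v + (d - 1) * y‖ ^ 2 / d) (‖v - y‖ ^ 2 / d) (‖x + (d - 1) * y‖ ^ 2 / d)
      (‖x - y‖ ^ 2 / d)

lemma IsUnbiased.receiverInfo_le_iff {d : ℕ} [NeZero d] {e : Fin d → Qudit d}
    (he : IsUnbiased e) (v x y : ℂ) :
    receiverInfo (complexCloner d v x y) e ≤ adversaryInfo (complexCloner d v x y) e ↔
      BreaksUnbiased d v x y := by
  have h1 : ∀ k l, cloneProb (complexCloner d v x y) (e k) (e l) =
      if k = l then ‖v‖ ^ 2 + (d - 1) * ‖y‖ ^ 2 else ‖x‖ ^ 2 + (d - 1) * ‖y‖ ^ 2 := by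
    intro k l
    split_ifs with h
    · rw [h, he.cloneProb_self]
    · exact he.cloneProb_of_ne v x y h
  simp only [receiverInfo, adversaryInfo, BreaksUnbiased, receiverInfoOf, adversaryInfoOf, h1,
    he.adversaryProb_eq]

/-! ### Reduction to real amplitudes -/

lemma norm_add_ofReal_mul_sq (v y : ℂ) (t : ℝ) :
    ‖v + t * y‖ ^ 2 = ‖v‖ ^ 2 + 2 * t * (v * star y).re + t ^ 2 * ‖y‖ ^ 2 := by
  simp only [Complex.sq_norm, Complex.normSq_apply]
  simp
  ring

lemma norm_add_mul_sq (d : ℕ) (v y : ℂ) :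
    ‖v + (d - 1) * y‖ ^ 2 =
      ‖v‖ ^ 2 + 2 * (d - 1) * (v * star y).re + ((d : ℝ) - 1) ^ 2 * ‖y‖ ^ 2 := by
  rw [← norm_add_ofReal_mul_sq]
  push_cast
  rfl

lemma norm_sub_sq' (v y : ℂ) :
    ‖v - y‖ ^ 2 = ‖v‖ ^ 2 - 2 * (v * star y).re + ‖y‖ ^ 2 := by
  have := norm_add_ofReal_mul_sq v y (-1)
  push_cast at this
  rw [neg_one_mul, ← sub_eq_add_neg] at this
  rw [this]
  ring

/-- Parseval for the Fourier transform of `(v, y, …, y)`; the total is blind to the relative phase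
of `v` and `y`. -/
lemma norm_sq_div_add_norm_sq_div (d : ℕ) [NeZero d] (v y : ℂ) :
    ‖v + (d - 1) * y‖ ^ 2 / d + (d - 1) * (‖v - y‖ ^ 2 / d) =
      ‖v‖ ^ 2 + (d - 1) * ‖y‖ ^ 2 := by
  have hd : (d : ℝ) ≠ 0 := Nat.cast_ne_zero.2 (NeZero.ne d)
  rw [norm_add_mul_sq, norm_sub_sq']
  field_simp
  ring

lemma branchEntropy_concave {d : ℕ} [NeZero d] {a b a₁ b₁ a₂ b₂ : ℝ} (ha : 0 ≤ a) (hb : 0 ≤ b)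
    (hab : a + b = 1) (ha₁ : 0 ≤ a₁) (hb₁ : 0 ≤ b₁) (ha₂ : 0 ≤ a₂) (hb₂ : 0 ≤ b₂) :
    a * branchEntropy d a₁ b₁ + b * branchEntropy d a₂ b₂ ≤
      branchEntropy d (a * a₁ + b * a₂) (a * b₁ + b * b₂) := by
  have hd1 : (0 : ℝ) ≤ d - 1 := by
    have : (1 : ℝ) ≤ d := by exact_mod_cast Nat.one_le_iff_ne_zero.2 (NeZero.ne d)
    linarith
  have hd0 : (0 : ℝ) ≤ (d : ℝ)⁻¹ := by positivity
  have key : ∀ s t : ℝ, 0 ≤ s → 0 ≤ t → a * Real.negMulLog ((d : ℝ)⁻¹ * s) +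
      b * Real.negMulLog ((d : ℝ)⁻¹ * t) ≤ Real.negMulLog ((d : ℝ)⁻¹ * (a * s + b * t)) := by
    intro s t hs ht
    have := Real.concaveOn_negMulLog.2 (Set.mem_Ici.2 (mul_nonneg hd0 hs))
      (Set.mem_Ici.2 (mul_nonneg hd0 ht)) ha hb hab
    simp only [smul_eq_mul] at this
    refine this.trans (le_of_eq (congrArg _ ?_))
    ring
  have h1 := key a₁ a₂ ha₁ ha₂
  have h2 := mul_le_mul_of_nonneg_left (key b₁ b₂ hb₁ hb₂) hd1
  simp only [branchEntropy]
  linarith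

/-- For fixed moduli both probabilities are affine in `(v * star y).re`, which ranges over an
interval. A concave function is smallest at an endpoint, and the endpoints are realized by `±‖v‖`
and `‖y‖`. -/
lemma exists_real_branchEntropy_le (d : ℕ) [NeZero d] (v y : ℂ) :
    ∃ v' : ℝ, ‖(v' : ℂ)‖ = ‖v‖ ∧
      branchEntropy d (‖(v' : ℂ) + (d - 1) * (‖y‖ : ℂ)‖ ^ 2 / d) (‖(v' : ℂ) - (‖y‖ : ℂ)‖ ^ 2 / d) ≤
        branchEntropy d (‖v + (d - 1) * y‖ ^ 2 / d) (‖v - y‖ ^ 2 / d) := by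
  have hc : (v * star y).re ∈ segment ℝ (-(‖v‖ * ‖y‖)) (‖v‖ * ‖y‖) := by
    have hM : 0 ≤ ‖v‖ * ‖y‖ := by positivity
    rw [segment_eq_Icc (by linarith), Set.mem_Icc, ← abs_le]
    refine (Complex.abs_re_le_norm _).trans ?_
    rw [norm_mul, norm_star]
  obtain ⟨a, b, ha, hb, hab, hc⟩ := hc
  simp only [smul_eq_mul] at hc
  have hre : ∀ s : ℝ, ((s : ℂ) * star (‖y‖ : ℂ)).re = s * ‖y‖ := fun s => by
    simp
  have hn : ∀ s : ℝ, ‖(s : ℂ)‖ ^ 2 = s ^ 2 := fun s => by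
    rw [Complex.norm_real, Real.norm_eq_abs, sq_abs]
  have hb1 : ‖v + (d - 1) * y‖ ^ 2 / d =
      a * (‖((-‖v‖ : ℝ) : ℂ) + (d - 1) * (‖y‖ : ℂ)‖ ^ 2 / d) +
        b * (‖(‖v‖ : ℂ) + (d - 1) * (‖y‖ : ℂ)‖ ^ 2 / d) := by
    simp only [norm_add_mul_sq, hre, hn, ← hc]
    rw [← sub_eq_iff_eq_add.2 hab.symm]
    ring
  have hb2 : ‖v - y‖ ^ 2 / d =
      a * (‖((-‖v‖ : ℝ) : ℂ) - (‖y‖ : ℂ)‖ ^ 2 / d) +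
        b * (‖(‖v‖ : ℂ) - (‖y‖ : ℂ)‖ ^ 2 / d) := by
    simp only [norm_sub_sq', hre, hn, ← hc]
    rw [← sub_eq_iff_eq_add.2 hab.symm]
    ring
  have key := branchEntropy_concave (d := d)
    (a₁ := ‖((-‖v‖ : ℝ) : ℂ) + (d - 1) * (‖y‖ : ℂ)‖ ^ 2 / d)
    (b₁ := ‖((-‖v‖ : ℝ) : ℂ) - (‖y‖ : ℂ)‖ ^ 2 / d)
    (a₂ := ‖(‖v‖ : ℂ) + (d - 1) * (‖y‖ : ℂ)‖ ^ 2 / d)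
    (b₂ := ‖(‖v‖ : ℂ) - (‖y‖ : ℂ)‖ ^ 2 / d)
    ha hb hab (by positivity) (by positivity) (by positivity) (by positivity)
  rw [← hb1, ← hb2] at key
  rcases le_total (branchEntropy d (‖((-‖v‖ : ℝ) : ℂ) + (d - 1) * (‖y‖ : ℂ)‖ ^ 2 / d)
    (‖((-‖v‖ : ℝ) : ℂ) - (‖y‖ : ℂ)‖ ^ 2 / d))
    (branchEntropy d (‖(‖v‖ : ℂ) + (d - 1) * (‖y‖ : ℂ)‖ ^ 2 / d)
      (‖(‖v‖ : ℂ) - (‖y‖ : ℂ)‖ ^ 2 / d)) with h | h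
  · refine ⟨-‖v‖, by simp, le_trans ?_ key⟩
    have := mul_le_mul_of_nonneg_left h hb
    have e : ∀ z : ℝ, z = a * z + b * z := fun z => by rw [← add_mul, hab, one_mul]
    refine (e _).le.trans ?_
    linarith
  · refine ⟨‖v‖, by simp, le_trans ?_ key⟩
    have := mul_le_mul_of_nonneg_left h ha
    have e : ∀ z : ℝ, z = a * z + b * z := fun z => by rw [← add_mul, hab, one_mul]
    refine (e _).le.trans ?_
    linarith

/-- The two branches share `y`, which is replaced by `‖y‖` in both, so the signs of `v'` and `x'`
can be chosen independently. Only the subtracted entropies change, and they decrease. -/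
lemma BreaksUnbiased.exists_real {d : ℕ} [NeZero d] {v x y : ℂ} (h : BreaksUnbiased d v x y) :
    ∃ v' x' y' : ℝ, ‖(v' : ℂ)‖ = ‖v‖ ∧ ‖(x' : ℂ)‖ = ‖x‖ ∧ ‖(y' : ℂ)‖ = ‖y‖ ∧
      BreaksUnbiased d v' x' y' := by
  obtain ⟨v', hv, hv'⟩ := exists_real_branchEntropy_le d v y
  obtain ⟨x', hx, hx'⟩ := exists_real_branchEntropy_le d x y
  have hy : ‖((‖y‖ : ℝ) : ℂ)‖ = ‖y‖ := by simp
  refine ⟨v', x', ‖y‖, hv, hx, hy, ?_⟩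
  unfold BreaksUnbiased at h ⊢
  rw [hv, hx, hy]
  refine h.trans ?_
  rw [adversaryInfoOf_eq, adversaryInfoOf_eq]
  simp only [norm_sq_div_add_norm_sq_div, hv, hx, hy]
  have hd1 : (0 : ℝ) ≤ d - 1 := by
    have : (1 : ℝ) ≤ d := by exact_mod_cast Nat.one_le_iff_ne_zero.2 (NeZero.ne d)
    linarith
  have := mul_le_mul_of_nonneg_left (add_le_add hv' (mul_le_mul_of_nonneg_left hx' hd1))
    (Nat.cast_nonneg (α := ℝ) d)
  linarith

/-! ### Existence of an optimal cloner -/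

/-- Every outcome is equally likely for both parties, so both informations vanish. This provides a
feasible point for the maximization. -/
lemma breaksUnbiased_uniform (d : ℕ) [NeZero d] (t : ℝ) (ht : t ^ 2 = (d : ℝ)⁻¹) :
    BreaksUnbiased d t t (0 : ℝ) := by
  have hd : (d : ℝ) ≠ 0 := Nat.cast_ne_zero.2 (NeZero.ne d)
  have hn : ‖(t : ℂ)‖ ^ 2 = (d : ℝ)⁻¹ := by
    rw [Complex.norm_real, Real.norm_eq_abs, sq_abs, ht]
  unfold BreaksUnbiased
  rw [adversaryInfoOf_eq]
  simp only [norm_sq_div_add_norm_sq_div, hn]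
  simp only [Complex.ofReal_zero, norm_zero, mul_zero, add_zero, sub_zero, hn,
    receiverInfoOf, mutualInfo, ite_self, Finset.sum_const, Finset.card_univ, Fintype.card_fin,
    nsmul_eq_mul, branchEntropy, ne_eq, OfNat.ofNat_ne_zero, not_false_eq_true, zero_pow]
  have hlog : Real.log ((d : ℝ)⁻¹) = - Real.log d := Real.log_inv _
  simp only [Real.negMulLog]
  have e1 : (d : ℝ)⁻¹ * ((d : ℝ)⁻¹ + (d - 1) * (d : ℝ)⁻¹) = (d : ℝ)⁻¹ := by field_simp; ring
  have e2 : (d : ℝ) * ((d : ℝ)⁻¹ * (d : ℝ)⁻¹) = (d : ℝ)⁻¹ := by field_simp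
  have e3 : (d : ℝ)⁻¹ * ((d : ℝ)⁻¹ / d) = (d : ℝ)⁻¹ * (d : ℝ)⁻¹ * (d : ℝ)⁻¹ := by
    rw [div_eq_mul_inv, mul_assoc]
  have hi : (d : ℝ)⁻¹ ≠ 0 := inv_ne_zero hd
  rw [e1, e2, e3, Real.log_mul (mul_ne_zero hi hi) hi, Real.log_mul hi hi, hlog]
  apply le_of_eq
  field_simp
  ring

/-- The fidelity on unbiased bases attains a maximum among the phase-covariant cloners that break
them, and the maximum is attained at real amplitudes. -/
lemma exists_real_maximizer (d : ℕ) (hd : 2 ≤ d) :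
    ∃ v x y : ℝ, ‖(v : ℂ)‖ ^ 2 + (d - 1) * ‖(x : ℂ)‖ ^ 2 + d * (d - 1) * ‖(y : ℂ)‖ ^ 2 = 1 ∧
      BreaksUnbiased d v x y ∧
      ∀ v' x' y' : ℂ, ‖v'‖ ^ 2 + (d - 1) * ‖x'‖ ^ 2 + d * (d - 1) * ‖y'‖ ^ 2 = 1 →
        BreaksUnbiased d v' x' y' →
        ‖v'‖ ^ 2 + (d - 1) * ‖y'‖ ^ 2 ≤ ‖(v : ℂ)‖ ^ 2 + (d - 1) * ‖(y : ℂ)‖ ^ 2 := by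
  have : NeZero d := ⟨by omega⟩
  have hd2 : (2 : ℝ) ≤ d := by exact_mod_cast hd
  let K : Set (ℝ × ℝ × ℝ) := {p | ‖(p.1 : ℂ)‖ ^ 2 + (d - 1) * ‖(p.2.1 : ℂ)‖ ^ 2 +
    d * (d - 1) * ‖(p.2.2 : ℂ)‖ ^ 2 = 1 ∧ BreaksUnbiased d p.1 p.2.1 p.2.2}
  have hclosed : IsClosed K := by
    have hbreaks : IsClosed {p : ℝ × ℝ × ℝ | BreaksUnbiased d p.1 p.2.1 p.2.2} := by
      unfold BreaksUnbiased
      refine isClosed_le ?_ ?_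
      · refine continuous_mutualInfo fun a b => ?_
        split_ifs <;> fun_prop
      · refine continuous_mutualInfo fun a b => ?_
        unfold adversaryPattern
        split_ifs <;> fun_prop
    exact (isClosed_eq (by fun_prop) continuous_const).inter hbreaks
  have hbound : K ⊆ Set.Icc (-1, -1, -1) (1, 1, 1) := by
    rintro ⟨v, x, y⟩ ⟨h, -⟩
    simp only [Complex.norm_real, Real.norm_eq_abs, sq_abs] at h
    have h2 : 0 ≤ ((d : ℝ) - 2) * x ^ 2 := mul_nonneg (by linarith) (sq_nonneg x)
    have h3 : 0 ≤ ((d : ℝ) * (d - 1) - 1) * y ^ 2 :=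
      mul_nonneg (by nlinarith) (sq_nonneg y)
    have hv : v ^ 2 ≤ 1 := by linarith [sq_nonneg x, sq_nonneg y]
    have hx : x ^ 2 ≤ 1 := by linarith [sq_nonneg v, sq_nonneg y]
    have hy : y ^ 2 ≤ 1 := by linarith [sq_nonneg v, sq_nonneg x]
    obtain ⟨v1, v2⟩ := abs_le.1 ((sq_le_one_iff_abs_le_one v).1 hv)
    obtain ⟨x1, x2⟩ := abs_le.1 ((sq_le_one_iff_abs_le_one x).1 hx)
    obtain ⟨y1, y2⟩ := abs_le.1 ((sq_le_one_iff_abs_le_one y).1 hy)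
    exact ⟨⟨v1, x1, y1⟩, ⟨v2, x2, y2⟩⟩
  have hcompact : IsCompact K := isCompact_Icc.of_isClosed_subset hclosed hbound
  have hne : K.Nonempty := by
    have ht : (Real.sqrt (d : ℝ)⁻¹) ^ 2 = (d : ℝ)⁻¹ := Real.sq_sqrt (by positivity)
    refine ⟨(Real.sqrt (d : ℝ)⁻¹, Real.sqrt (d : ℝ)⁻¹, 0), ?_, breaksUnbiased_uniform d _ ht⟩
    simp only [Complex.norm_real, Real.norm_eq_abs, sq_abs, ht]
    field_simp
    ring
  obtain ⟨⟨v, x, y⟩, ⟨h1, h2⟩, hmax⟩ := hcompact.exists_isMaxOn hne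
    (f := fun p => ‖(p.1 : ℂ)‖ ^ 2 + (d - 1) * ‖(p.2.2 : ℂ)‖ ^ 2) (by fun_prop)
  refine ⟨v, x, y, h1, h2, fun v' x' y' h1' h2' => ?_⟩
  -- The objective and the normalization see only moduli, so a complex competitor may be exchanged
  -- for a real one.
  obtain ⟨v'', x'', y'', hv, hx, hy, h2''⟩ := h2'.exists_real
  have hmem : (v'', x'', y'') ∈ K := ⟨by simp only [hv, hx, hy, h1'], h2''⟩
  have := hmax hmem
  simpa only [Set.mem_ofPred_eq, hv, hy] using this

/-- A cloner that breaks one unbiased basis and attains on it the maximal fidelity is optimal for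
every set of unbiased bases. -/
lemma isOptimalCloner_of_isUnbiased {d : ℕ} (hd : 2 ≤ d) {F : ℝ}
    (hF : ∀ v x y : ℂ, ‖v‖ ^ 2 + (d - 1) * ‖x‖ ^ 2 + d * (d - 1) * ‖y‖ ^ 2 = 1 →
      BreaksUnbiased d v x y → ‖v‖ ^ 2 + (d - 1) * ‖y‖ ^ 2 ≤ F)
    {v x y : ℂ} (hV : IsPhaseCovariantCloner (complexCloner d v x y))
    (hb : BreaksUnbiased d v x y) (hf : ‖v‖ ^ 2 + (d - 1) * ‖y‖ ^ 2 = F)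
    {S : Set (Fin d → Qudit d)} (hS : ∀ e ∈ S, IsUnbiased e) :
    IsOptimalCloner S (complexCloner d v x y) F := by
  have : NeZero d := ⟨by omega⟩
  refine ⟨hV, fun e he => ((hS e he).receiverInfo_le_iff v x y).2 hb, fun e he k => ?_, ?_⟩
  · rw [fidelity, (hS e he).cloneProb_self, hf]
  · intro W hW hWb e he k
    obtain ⟨v', x', y', rfl⟩ := hW.exists_eq_complexCloner hd
    rw [fidelity, (hS e he).cloneProb_self]
    exact hF v' x' y' (isPhaseCovariantCloner_complexCloner.1 hW)
      (((hS e he).receiverInfo_le_iff v' x' y').1 (hWb e he))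

end QuditCloning

end

theorem proposition2 (d : ℕ) (hd : 2 ≤ d) :
    ∃ F v x y : ℝ, ∀ θ : ℂ, ‖θ‖ = 1 →
      QuditCloning.IsOptimalCloner (QuditCloning.ndebBases d θ)
        (QuditCloning.bellCloner d v x y) F ∧
      ∀ V : QuditCloning.Machine d,
        QuditCloning.IsOptimalCloner (QuditCloning.ndebBases d θ) V F →
          (∀ e ∈ QuditCloning.hddebBases d θ, ∀ k, QuditCloning.IsPhaseState (e k)) ∧
          QuditCloning.IsOptimalCloner (QuditCloning.ditterBases d) V F ∧
          QuditCloning.IsOptimalCloner (QuditCloning.hddebBases d θ) V F ∧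
          ∀ e ∈ QuditCloning.hddebBases d θ, QuditCloning.IsOptimalCloner {e} V F := by
  have : NeZero d := ⟨by omega⟩
  obtain ⟨v, x, y, hnorm, hbreaks, hmax⟩ := QuditCloning.exists_real_maximizer d hd
  refine ⟨‖(v : ℂ)‖ ^ 2 + (d - 1) * ‖(y : ℂ)‖ ^ 2, v, x, y, fun θ hθ => ?_⟩
  have hndeb : ∀ e ∈ QuditCloning.ndebBases d θ, QuditCloning.IsUnbiased e := fun e he =>
    QuditCloning.isUnbiased_of_mem_ditterBases (QuditCloning.ndebBases_subset_ditterBases hθ he)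
  have hhddeb : ∀ e ∈ QuditCloning.hddebBases d θ, QuditCloning.IsUnbiased e := fun e he =>
    QuditCloning.isUnbiased_of_mem_hddebBases hθ he
  constructor
  · rw [QuditCloning.bellCloner_eq_complexCloner]
    exact QuditCloning.isOptimalCloner_of_isUnbiased hd hmax
      (QuditCloning.isPhaseCovariantCloner_complexCloner.2 hnorm) hbreaks rfl hndeb
  · intro V hV
    obtain ⟨v', x', y', rfl⟩ := hV.phaseCovariant.exists_eq_complexCloner hd
    -- A single N-DEB basis already yields the basis-independent condition and the fidelity formula
    -- for `V`.
    obtain ⟨e₀, he₀⟩ := QuditCloning.ndebBases_nonempty (d := d) hθ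
    have hb : QuditCloning.BreaksUnbiased d v' x' y' :=
      ((hndeb e₀ he₀).receiverInfo_le_iff v' x' y').1 (hV.breaks e₀ he₀)
    have hf := hV.fidelity_eq e₀ he₀ (0 : Fin d)
    rw [QuditCloning.fidelity, (hndeb e₀ he₀).cloneProb_self v' x' y'] at hf
    have hopt : ∀ S : Set (Fin d → QuditCloning.Qudit d),
        (∀ e ∈ S, QuditCloning.IsUnbiased e) →
          QuditCloning.IsOptimalCloner S (QuditCloning.complexCloner d v' x' y') _ := fun S hS =>
      QuditCloning.isOptimalCloner_of_isUnbiased hd hmax hV.phaseCovariant hb hf hS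
    refine ⟨fun e he k => (hhddeb e he).isPhaseState k, hopt _ fun e he =>
      QuditCloning.isUnbiased_of_mem_ditterBases he, hopt _ hhddeb, fun e he => hopt _ ?_⟩
    rintro _ rfl
    exact hhddeb _ he
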